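/- Consider $N\ge 2$ agents on an undirected weighted graph with symmetric weights $a_{ij}\ge 0$ (agents $i\neq j$ being linked iff $a_{ij}>0$), with Laplacian $L_G=\mathrm{diag}\big(\sum_j a_{ij}\big)_i-[a_{ij}]$ whose eigenvalues, with multiplicity, are $0=\lambda_1\le\lambda_2\le\cdots\le\lambda_N$. The agents have dynamics $$x_i(k+1)=Ax_i(k)+\gamma(k)Bu_i(k-d),\qquad k\ge 0,\ i=1,\dots,N,$$ where $A\in\mathbb R^{n\times n}$, $B\in\mathbb R^{n\times m}$, $d\ge 0$ is an integer delay, and $\{\gamma(k)\}_{k\ge 0}$ are i.i.d. with $P(\gamma(k)=0)=p$, $P(\gamma(k)=1)=1-p=:\mu$, $p\in(0,1)$; the initial values $x_i(0),u_i(-1),\dots,u_i(-d)$ are deterministic. The predictor-like protocol with gain $K\in\mathbb R^{m\times n}$ is, for $k\ge d$, $$u_i(k-d)=K\sum_{j=1}^N a_{ij}\big[\hat x_j(k|k-d)-\hat x_i(k|k-d)\big],\qquad \hat x_i(k|k-d)=A^dx_i(k-d)+\mu\sum_{j=1}^{d}A^{j-1}Bu_i(k-d-j).$$ The system is called mean-square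 consensusable under this protocol if for all initial values $x_i(0),u_i(-1),\dots,u_i(-d)$, $i=1,\dots,N$, there exists $K$ such that $\lim_{k\to\infty}E\|x_j(k)-x_i(k)\|^2=0$ for all $i,j$. Theorem. Assume that all eigenvalues of $A$ lie on or outside the unit circle, that $B$ has full column rank, that $\mathrm{rank}(B)=1$, that the graph is connected, and that $\lambda_2\neq\lambda_N$. If the system is mean-square consensusable under the predictor-like protocol, then $$\prod_i|\lambda_i^u(A)|^2<\left(\frac{1+\lambda_2/\lambda_N}{1-\lambda_2/\lambda_N}\right)^2,$$ where $\lambda_i^u(A)$ are the unstable eigenvalues of $A$ (those of modulus at least $1$), counted with algebraic multiplicity. (When $\lambda_2=\lambda_N$ the right-hand side is read as $+\infty$ and there is no condition.) -/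

import Mathlib

open MeasureTheory ProbabilityTheory Filter Topology
open scoped ENNReal

/-- An undirected weighted communication graph on `N` agents: a symmetric matrix of
nonnegative weights, agents `i` and `j` being linked when their weight is positive. -/
structure CommGraph (N : ℕ) where
  /-- The weighted adjacency matrix. -/
  weight : Matrix (Fin N) (Fin N) ℝ
  symm : weight.IsSymm
  nonneg : ∀ i j, 0 ≤ weight i j

namespace CommGraph

variable {N : ℕ} (G : CommGraph N)

/-- The underlying simple graph (only links between distinct agents matter). -/
def toSimpleGraph : SimpleGraph (Fin N) :=
  SimpleGraph.fromRel fun i j => 0 < G.weight i j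

/-- The graph Laplacian: degree matrix minus weighted adjacency matrix. -/
def laplacian : Matrix (Fin N) (Fin N) ℝ :=
  Matrix.diagonal (fun i => ∑ j, G.weight i j) - G.weight

theorem laplacian_isHermitian : G.laplacian.IsHermitian := by
  rw [Matrix.IsHermitian, Matrix.conjTranspose_eq_transpose_of_trivial, laplacian,
    Matrix.transpose_sub, Matrix.diagonal_transpose, G.symm]

/-- The eigenvalues of the Laplacian, with multiplicity, in ascending order (indexed from 0). -/
noncomputable def eig (i : Fin N) : ℝ :=
  G.laplacian_isHermitian.eigenvalues (Tuple.sort G.laplacian_isHermitian.eigenvalues i)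

theorem eig_monotone : Monotone G.eig :=
  Tuple.monotone_sort G.laplacian_isHermitian.eigenvalues

end CommGraph

/-- The complex eigenvalues of a real square matrix, with algebraic multiplicity. -/
noncomputable def complexEigenvalues {n : ℕ} (A : Matrix (Fin n) (Fin n) ℝ) : Multiset ℂ :=
  (A.map (algebraMap ℝ ℂ)).charpoly.roots

open Classical in
/-- The unstable eigenvalues (on or outside the unit circle), with algebraic multiplicity. -/
noncomputable def unstableEigenvalues {n : ℕ} (A : Matrix (Fin n) (Fin n) ℝ) : Multiset ℂ :=
  (complexEigenvalues A).filter fun z => 1 ≤ ‖z‖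

/-- The data available at time `k`: the states `x_i(k)`, and the past inputs, with
`past j i = u_i(k - 1 - j)`. -/
structure LoopState (N n m : ℕ) where
  x : Fin N → Fin n → ℝ
  past : ℕ → Fin N → Fin m → ℝ

section ClosedLoop

variable {N n m : ℕ}

/-- The predictor `x̂_i(k + d | k) = A^d x_i(k) + μ ∑_{j=1}^d A^{j-1} B u_i(k - j)`,
computed from the data at time `k`. -/
noncomputable def predictor (A : Matrix (Fin n) (Fin n) ℝ) (B : Matrix (Fin n) (Fin m) ℝ)
    (μ : ℝ) (d : ℕ) (s : LoopState N n m) (i : Fin N) : Fin n → ℝ :=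
  (A ^ d).mulVec (s.x i) + μ • ∑ j ∈ Finset.Icc 1 d, (A ^ (j - 1) * B).mulVec (s.past (j - 1) i)

/-- The input `u_i(k) = K ∑_j a_ij (x̂_j(k + d | k) - x̂_i(k + d | k))`. -/
noncomputable def protocolInput (G : CommGraph N) (A : Matrix (Fin n) (Fin n) ℝ)
    (B : Matrix (Fin n) (Fin m) ℝ) (μ : ℝ) (d : ℕ) (K : Matrix (Fin m) (Fin n) ℝ)
    (s : LoopState N n m) (i : Fin N) : Fin m → ℝ :=
  K.mulVec (∑ j, G.weight i j • (predictor A B μ d s j - predictor A B μ d s i))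

/-- The inputs known once those of time `k` have been computed:
`extendInputs u past j i = u_i(k - j)`. -/
def extendInputs (u : Fin N → Fin m → ℝ) (past : ℕ → Fin N → Fin m → ℝ) :
    ℕ → Fin N → Fin m → ℝ
  | 0 => u
  | j + 1 => past j

/-- One time step `x_i(k + 1) = A x_i(k) + g B u_i(k - d)`, where `g` is the value of `γ(k)`. -/
noncomputable def loopStep (G : CommGraph N) (A : Matrix (Fin n) (Fin n) ℝ)
    (B : Matrix (Fin n) (Fin m) ℝ) (μ : ℝ) (d : ℕ) (K : Matrix (Fin m) (Fin n) ℝ)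
    (g : ℝ) (s : LoopState N n m) : LoopState N n m where
  x i := A.mulVec (s.x i)
    + g • B.mulVec (extendInputs (protocolInput G A B μ d K s) s.past d i)
  past := extendInputs (protocolInput G A B μ d K s) s.past

/-- The closed-loop trajectory along the packet arrival path `g`, from the initial states `x0 i`
and the initial inputs `u_i(-1-j) = u0 j i`, `j < d` (older inputs never enter). -/
noncomputable def closedLoop (G : CommGraph N) (A : Matrix (Fin n) (Fin n) ℝ)
    (B : Matrix (Fin n) (Fin m) ℝ) (μ : ℝ) (d : ℕ) (K : Matrix (Fin m) (Fin n) ℝ)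
    (x0 : Fin N → Fin n → ℝ) (u0 : Fin d → Fin N → Fin m → ℝ) (g : ℕ → ℝ) :
    ℕ → LoopState N n m
  | 0 => ⟨x0, fun j => if h : j < d then u0 ⟨j, h⟩ else 0⟩
  | k + 1 => loopStep G A B μ d K (g k) (closedLoop G A B μ d K x0 u0 g k)

/-- Mean-square consensusability under the predictor-like protocol, with dropout rate `p` and
packet arrival process `γ`: for all initial values there is a gain `K` such that
`E ‖x_j(k) - x_i(k)‖² → 0` (Euclidean norm) for all agents `i`, `j`. -/
def MeanSquareConsensusable {Ω : Type*} [MeasurableSpace Ω] (P : Measure Ω) (γ : ℕ → Ω → ℝ)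
    (p : ℝ) (d : ℕ) (G : CommGraph N) (A : Matrix (Fin n) (Fin n) ℝ)
    (B : Matrix (Fin n) (Fin m) ℝ) : Prop :=
  ∀ (x0 : Fin N → Fin n → ℝ) (u0 : Fin d → Fin N → Fin m → ℝ),
    ∃ K : Matrix (Fin m) (Fin n) ℝ, ∀ i j : Fin N,
      Tendsto (fun k : ℕ => ∫⁻ ω,
          ‖WithLp.toLp 2 ((closedLoop G A B (1 - p) d K x0 u0 (fun t => γ t ω) k).x j
            - (closedLoop G A B (1 - p) d K x0 u0 (fun t => γ t ω) k).x i)‖ₑ ^ 2 ∂P)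
        atTop (𝓝 0)

end ClosedLoop

/-- `γ` is an i.i.d. Bernoulli process: `γ(k) = 0` with probability `p`, and `γ(k) = 1` with
probability `1 - p`. -/
structure IsPacketProcess {Ω : Type*} [MeasurableSpace Ω] (P : Measure Ω) (γ : ℕ → Ω → ℝ)
    (p : ℝ) : Prop where
  measurable : ∀ k, Measurable (γ k)
  indep : iIndepFun γ P
  prob_zero : ∀ k, P {ω | γ k ω = 0} = ENNReal.ofReal p
  prob_one : ∀ k, P {ω | γ k ω = 1} = ENNReal.ofReal (1 - p)

/-!
In expectation the closed loop is a deterministic loop in which every packet is replaced by its mean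
`μ = 1 - p` (`hasPathMean_closedLoop`), because `γ k` is independent of the data available at time
`k`; mean-square consensus therefore forces consensus of the averaged loop. There the predictor is
exactly the state `d` steps later, and its component along a Laplacian eigenvector with eigenvalue
`c` follows the powers of `A - c μ B K` (`sum_smul_predictor`). So for every `ζ` there is a gain `K`
for which `(A - c μ B K) ^ k ζ → 0`, simultaneously for `c = λ₂` and `c = λ_N`
(`MeanSquareConsensusable.exists_gain`).

The gain may depend on the initial values, hence on `ζ`, so stability of `A - c μ B K` is not
immediate. Letting `ζ` be a coordinate vector that a hypothetical left eigenvector of `A`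
annihilating `B` does not annihilate shows that `(A, B)` is controllable, since the eigenvalues of
`A` have modulus at least one (`controllable_of_steerable`). Then `ζ = B` is used: the states
contracted by one fixed closed loop form an `A`-invariant subspace containing `B`, which by
controllability is the whole space, so that the determinant of `A - c μ B K` has modulus less than
one (`abs_det_lt_one_of_tendsto`), with the same `K` for `λ₂` and `λ_N`.

Finally `B K` has rank at most one, so `det (A - c μ B K)` is an affine function of `c`. Being less
than one in modulus at `λ₂` and at `λ_N`, it is less than `(λ_N + λ₂) / (λ_N - λ₂)` in modulus at
`c = 0`, where it is `det A`, the product of the eigenvalues (`abs_lt_of_affine`). Connectedness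
enters through `0 < λ₂`.
-/

/-! ### The mean of the closed loop -/

/-- The sigma-algebra generated by `γ 0, …, γ (k - 1)`. -/
abbrev pathSigma {Ω : Type*} (γ : ℕ → Ω → ℝ) (k : ℕ) : MeasurableSpace Ω :=
  ⨆ t ∈ Set.Iio k, MeasurableSpace.comap (γ t) inferInstance

/-- `f` is an essentially bounded function of `γ 0, …, γ (k - 1)` whose expectation is `c`. -/
structure HasPathMean {Ω : Type*} [MeasurableSpace Ω] (P : Measure Ω) (γ : ℕ → Ω → ℝ)
    (k : ℕ) (f : Ω → ℝ) (c : ℝ) : Prop where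
  measurable_path : Measurable[pathSigma γ k] f
  bounded : ∃ C : ℝ, ∀ᵐ ω ∂P, ‖f ω‖ ≤ C
  integral_eq : ∫ ω, f ω ∂P = c

theorem pathSigma_mono {Ω : Type*} (γ : ℕ → Ω → ℝ) {k l : ℕ} (h : k ≤ l) :
    pathSigma γ k ≤ pathSigma γ l :=
  biSup_mono fun _ ht => lt_of_lt_of_le ht h

section PathMean

variable {Ω : Type*} [MeasurableSpace Ω] {P : Measure Ω} {γ : ℕ → Ω → ℝ} {p : ℝ}

theorem IsPacketProcess.pathSigma_le (hγ : IsPacketProcess P γ p) (k : ℕ) :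
    pathSigma γ k ≤ ‹MeasurableSpace Ω› :=
  iSup₂_le fun t _ => (hγ.measurable t).comap_le

namespace HasPathMean

variable {k : ℕ} {f : Ω → ℝ} {a : ℝ}

theorem mono {l : ℕ} (hf : HasPathMean P γ k f a) (h : k ≤ l) : HasPathMean P γ l f a :=
  ⟨hf.measurable_path.mono (pathSigma_mono γ h) le_rfl, hf.bounded, hf.integral_eq⟩

theorem const_mul (c : ℝ) (hf : HasPathMean P γ k f a) :
    HasPathMean P γ k (fun ω => c * f ω) (c * a) := by
  refine ⟨Measurable.const_mul hf.measurable_path c, ?_, ?_⟩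
  · obtain ⟨C, hC⟩ := hf.bounded
    refine ⟨‖c‖ * C, ?_⟩
    filter_upwards [hC] with ω h
    rw [norm_mul]
    gcongr
  · rw [integral_const_mul, hf.integral_eq]

end HasPathMean

variable [IsProbabilityMeasure P]

theorem IsPacketProcess.ae_mem (hγ : IsPacketProcess P γ p) (hp0 : 0 < p) (hp1 : p < 1) (k : ℕ) :
    ∀ᵐ ω ∂P, γ k ω = 0 ∨ γ k ω = 1 := by
  have h0 : MeasurableSet {ω | γ k ω = 0} := hγ.measurable k (measurableSet_singleton 0)
  have h1 : MeasurableSet {ω | γ k ω = 1} := hγ.measurable k (measurableSet_singleton 1)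
  have hd : Disjoint {ω | γ k ω = 0} {ω | γ k ω = 1} := by
    rw [Set.disjoint_left]
    intro ω h h'
    simp only [Set.mem_ofPred_eq] at h h'
    linarith
  have hu : P ({ω | γ k ω = 0} ∪ {ω | γ k ω = 1}) = 1 := by
    rw [measure_union hd h1, hγ.prob_zero, hγ.prob_one, ← ENNReal.ofReal_add hp0.le (by linarith)]
    simp
  exact (prob_compl_eq_zero_iff (h0.union h1)).2 hu

theorem IsPacketProcess.integral_eq (hγ : IsPacketProcess P γ p) (hp0 : 0 < p) (hp1 : p < 1)
    (k : ℕ) : ∫ ω, γ k ω ∂P = 1 - p := by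
  have h1 : MeasurableSet {ω | γ k ω = 1} := hγ.measurable k (measurableSet_singleton 1)
  have h : γ k =ᵐ[P] {ω | γ k ω = 1}.indicator 1 := by
    filter_upwards [hγ.ae_mem hp0 hp1 k] with ω hω
    rcases hω with hω | hω <;> simp [Set.indicator, hω]
  rw [integral_congr_ae h, integral_indicator_one h1, measureReal_def, hγ.prob_one,
    ENNReal.toReal_ofReal (by linarith)]

namespace HasPathMean

variable {k : ℕ} {f g : Ω → ℝ} {a b : ℝ}

theorem integrable (hγ : IsPacketProcess P γ p) (hf : HasPathMean P γ k f a) :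
    Integrable f P := by
  obtain ⟨C, hC⟩ := hf.bounded
  exact Integrable.of_bound
    (hf.measurable_path.mono (hγ.pathSigma_le k) le_rfl).aestronglyMeasurable C hC

theorem const (c : ℝ) : HasPathMean P γ k (fun _ => c) c :=
  ⟨measurable_const, ⟨‖c‖, by simp⟩, by simp⟩

theorem add (hγ : IsPacketProcess P γ p) (hf : HasPathMean P γ k f a)
    (hg : HasPathMean P γ k g b) : HasPathMean P γ k (fun ω => f ω + g ω) (a + b) := by
  refine ⟨Measurable.add hf.measurable_path hg.measurable_path, ?_, ?_⟩
  · obtain ⟨C, hC⟩ := hf.bounded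
    obtain ⟨D, hD⟩ := hg.bounded
    refine ⟨C + D, ?_⟩
    filter_upwards [hC, hD] with ω h h'
    exact norm_add_le_of_le h h'
  · rw [integral_add (hf.integrable hγ) (hg.integrable hγ), hf.integral_eq, hg.integral_eq]

theorem sub (hγ : IsPacketProcess P γ p) (hf : HasPathMean P γ k f a)
    (hg : HasPathMean P γ k g b) : HasPathMean P γ k (fun ω => f ω - g ω) (a - b) := by
  simpa [sub_eq_add_neg] using hf.add hγ (hg.const_mul (-1))

theorem sum (hγ : IsPacketProcess P γ p) {ι : Type*} (s : Finset ι) {f : ι → Ω → ℝ} {c : ι → ℝ}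
    (hf : ∀ i ∈ s, HasPathMean P γ k (f i) (c i)) :
    HasPathMean P γ k (fun ω => ∑ i ∈ s, f i ω) (∑ i ∈ s, c i) := by
  classical
  induction s using Finset.induction_on with
  | empty => simpa using const 0
  | insert i s hi ih =>
    simp only [Finset.sum_insert hi]
    exact (hf i (s.mem_insert_self i)).add hγ (ih fun j hj => hf j (Finset.mem_insert_of_mem hj))

theorem mulVec (hγ : IsPacketProcess P γ p) {r q : ℕ} (M : Matrix (Fin r) (Fin q) ℝ)
    {v : Ω → Fin q → ℝ} {c : Fin q → ℝ} (hv : ∀ i, HasPathMean P γ k (fun ω => v ω i) (c i))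
    (i : Fin r) : HasPathMean P γ k (fun ω => M.mulVec (v ω) i) (M.mulVec c i) := by
  simp only [Matrix.mulVec, dotProduct]
  exact sum hγ _ fun j _ => (hv j).const_mul _

/-- The packet indicator `γ k` is independent of the earlier ones, so that it multiplies
expectations by its own mean `1 - p`. -/
theorem packet_mul (hγ : IsPacketProcess P γ p) (hp0 : 0 < p) (hp1 : p < 1)
    (hf : HasPathMean P γ k f a) :
    HasPathMean P γ (k + 1) (fun ω => γ k ω * f ω) ((1 - p) * a) := by
  have hk : Measurable[pathSigma γ (k + 1)] (γ k) :=
    (comap_measurable (γ k)).mono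
      (le_iSup₂_of_le (f := fun t (_ : t ∈ Set.Iio (k + 1)) =>
        MeasurableSpace.comap (γ t) inferInstance) k (Nat.lt_succ_self k) le_rfl) le_rfl
  refine ⟨Measurable.mul hk (hf.mono (Nat.le_succ k)).measurable_path, ?_, ?_⟩
  · obtain ⟨C, hC⟩ := hf.bounded
    refine ⟨C, ?_⟩
    filter_upwards [hC, hγ.ae_mem hp0 hp1 k] with ω h h'
    have hC0 : 0 ≤ C := (norm_nonneg _).trans h
    rcases h' with h' | h' <;> simpa [h'] using by assumption
  · have hind : Indep (⨆ t ∈ ({k} : Set ℕ), MeasurableSpace.comap (γ t) inferInstance)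
        (pathSigma γ k) P :=
      indep_iSup_of_disjoint (fun t => (hγ.measurable t).comap_le) hγ.indep
        (Set.disjoint_left.2 fun t ht ht' => by
          simp only [Set.mem_singleton_iff, Set.mem_Iio] at ht ht'; omega)
    have hind' : IndepFun (γ k) f P := by
      refine indep_of_indep_of_le_right (indep_of_indep_of_le_left hind ?_) ?_
      · simp
      · exact hf.measurable_path.comap_le
    rw [← hγ.integral_eq hp0 hp1 k, ← hf.integral_eq]
    exact hind'.integral_fun_mul_eq_mul_integral (hγ.measurable k).aestronglyMeasurable
      (hf.integrable hγ).aestronglyMeasurable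

end HasPathMean

variable {N n m : ℕ}

theorem hasPathMean_predictor (hγ : IsPacketProcess P γ p) {k : ℕ} (A : Matrix (Fin n) (Fin n) ℝ)
    (B : Matrix (Fin n) (Fin m) ℝ) (μ : ℝ) (d : ℕ) {s : Ω → LoopState N n m}
    {s' : LoopState N n m}
    (hx : ∀ i a, HasPathMean P γ k (fun ω => (s ω).x i a) (s'.x i a))
    (hu : ∀ j i a, HasPathMean P γ k (fun ω => (s ω).past j i a) (s'.past j i a))
    (i : Fin N) (a : Fin n) :
    HasPathMean P γ k (fun ω => predictor A B μ d (s ω) i a) (predictor A B μ d s' i a) := by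
  simp only [predictor, Pi.add_apply, Pi.smul_apply, Finset.sum_apply, smul_eq_mul]
  exact (HasPathMean.mulVec hγ _ (hx i) a).add hγ
    ((HasPathMean.sum hγ _ fun j _ => HasPathMean.mulVec hγ _ (hu (j - 1) i) a).const_mul μ)

theorem hasPathMean_protocolInput (hγ : IsPacketProcess P γ p) {k : ℕ} (G : CommGraph N)
    (A : Matrix (Fin n) (Fin n) ℝ) (B : Matrix (Fin n) (Fin m) ℝ) (μ : ℝ) (d : ℕ)
    (K : Matrix (Fin m) (Fin n) ℝ) {s : Ω → LoopState N n m} {s' : LoopState N n m}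
    (hx : ∀ i a, HasPathMean P γ k (fun ω => (s ω).x i a) (s'.x i a))
    (hu : ∀ j i a, HasPathMean P γ k (fun ω => (s ω).past j i a) (s'.past j i a))
    (i : Fin N) (a : Fin m) :
    HasPathMean P γ k (fun ω => protocolInput G A B μ d K (s ω) i a)
      (protocolInput G A B μ d K s' i a) := by
  simp only [protocolInput]
  refine HasPathMean.mulVec hγ _ (fun b => ?_) a
  simp only [Finset.sum_apply, Pi.smul_apply, Pi.sub_apply, smul_eq_mul]
  exact HasPathMean.sum hγ _ fun j _ =>
    ((hasPathMean_predictor hγ A B μ d hx hu j b).sub hγ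
      (hasPathMean_predictor hγ A B μ d hx hu i b)).const_mul _

/-- In expectation the closed loop is the deterministic loop in which every packet is replaced by
its mean `1 - p`. -/
theorem hasPathMean_closedLoop (hγ : IsPacketProcess P γ p) (hp0 : 0 < p) (hp1 : p < 1)
    (G : CommGraph N) (A : Matrix (Fin n) (Fin n) ℝ) (B : Matrix (Fin n) (Fin m) ℝ) (μ : ℝ)
    (d : ℕ) (K : Matrix (Fin m) (Fin n) ℝ) (x0 : Fin N → Fin n → ℝ)
    (u0 : Fin d → Fin N → Fin m → ℝ) (k : ℕ) :
    (∀ i a, HasPathMean P γ k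
        (fun ω => (closedLoop G A B μ d K x0 u0 (fun t => γ t ω) k).x i a)
        ((closedLoop G A B μ d K x0 u0 (fun _ => 1 - p) k).x i a)) ∧
      ∀ j i a, HasPathMean P γ k
        (fun ω => (closedLoop G A B μ d K x0 u0 (fun t => γ t ω) k).past j i a)
        ((closedLoop G A B μ d K x0 u0 (fun _ => 1 - p) k).past j i a) := by
  induction k with
  | zero => exact ⟨fun i a => HasPathMean.const _, fun j i a => HasPathMean.const _⟩
  | succ k ih =>
    obtain ⟨hx, hu⟩ := ih
    have he : ∀ j i a, HasPathMean P γ k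
        (fun ω => extendInputs
          (protocolInput G A B μ d K (closedLoop G A B μ d K x0 u0 (fun t => γ t ω) k))
          (closedLoop G A B μ d K x0 u0 (fun t => γ t ω) k).past j i a)
        (extendInputs
          (protocolInput G A B μ d K (closedLoop G A B μ d K x0 u0 (fun _ => 1 - p) k))
          (closedLoop G A B μ d K x0 u0 (fun _ => 1 - p) k).past j i a) := by
      rintro (_ | j) i a
      · exact hasPathMean_protocolInput hγ G A B μ d K hx hu i a
      · exact hu j i a
    refine ⟨fun i a => ?_, fun j i a => (he j i a).mono (Nat.le_succ k)⟩
    simp only [closedLoop, loopStep, Pi.add_apply, Pi.smul_apply, smul_eq_mul]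
    exact ((HasPathMean.mulVec hγ A (hx i) a).mono (Nat.le_succ k)).add hγ
      ((HasPathMean.mulVec hγ B (he d i) a).packet_mul hγ hp0 hp1)

/-- Jensen's inequality: mean-square convergence to zero of vectors forces convergence to zero
of the expectations of their coordinates. -/
theorem tendsto_integral_coord {f : ℕ → Ω → Fin n → ℝ} (a : Fin n)
    (hf : ∀ k, Integrable (fun ω => f k ω a) P)
    (h : Tendsto (fun k => ∫⁻ ω, ‖WithLp.toLp 2 (f k ω)‖ₑ ^ 2 ∂P) atTop (𝓝 0)) :
    Tendsto (fun k => ∫ ω, f k ω a ∂P) atTop (𝓝 0) := by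
  have key : ∀ k, ‖∫ ω, f k ω a ∂P‖ₑ ^ 2 ≤ ∫⁻ ω, ‖WithLp.toLp 2 (f k ω)‖ₑ ^ 2 ∂P := by
    intro k
    have h1 : ‖∫ ω, f k ω a ∂P‖ₑ ≤ eLpNorm (fun ω => f k ω a) 2 P := by
      refine (enorm_integral_le_lintegral_enorm _).trans ?_
      rw [← eLpNorm_one_eq_lintegral_enorm]
      exact eLpNorm_le_eLpNorm_of_exponent_le (by norm_num) (hf k).aestronglyMeasurable
    refine (pow_le_pow_left₀ (by simp) h1 2).trans ?_
    have h2 := eLpNorm_nnreal_pow_eq_lintegral (μ := P) (f := fun ω => f k ω a) (p := 2)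
      (by norm_num)
    norm_num at h2
    rw [h2]
    refine lintegral_mono fun ω => ?_
    gcongr
    simpa using (enorm_le_iff_norm_le.2 (PiLp.norm_apply_le (WithLp.toLp 2 (f k ω)) a))
  have h2 : Tendsto (fun k => ‖∫ ω, f k ω a ∂P‖ₑ ^ 2) atTop (𝓝 0) :=
    tendsto_of_tendsto_of_tendsto_of_le_of_le tendsto_const_nhds h (fun _ => by simp) key
  rw [tendsto_zero_iff_enorm_tendsto_zero]
  have h3 := (ENNReal.continuous_rpow_const (y := (2 : ℝ)⁻¹)).tendsto 0 |>.comp h2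
  have hroot : ∀ x : ℝ≥0∞, (x ^ 2) ^ (2 : ℝ)⁻¹ = x := fun x => by
    rw [← ENNReal.rpow_natCast, ← ENNReal.rpow_mul]
    norm_num
  simpa only [Function.comp_def, hroot, ENNReal.zero_rpow_of_pos (by norm_num : (0 : ℝ) < 2⁻¹)]
    using h3

end PathMean

/-- Mean-square consensusability of the stochastic loop forces consensus of the averaged
deterministic loop. -/
theorem MeanSquareConsensusable.averaged {Ω : Type*} [MeasurableSpace Ω] {P : Measure Ω}
    [IsProbabilityMeasure P] {N n m d : ℕ} {p : ℝ} (hp0 : 0 < p) (hp1 : p < 1) {γ : ℕ → Ω → ℝ}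
    (hγ : IsPacketProcess P γ p) {G : CommGraph N} {A : Matrix (Fin n) (Fin n) ℝ}
    {B : Matrix (Fin n) (Fin m) ℝ} (hcons : MeanSquareConsensusable P γ p d G A B)
    (x0 : Fin N → Fin n → ℝ) (u0 : Fin d → Fin N → Fin m → ℝ) :
    ∃ K : Matrix (Fin m) (Fin n) ℝ, ∀ i j : Fin N,
      Tendsto (fun k => (closedLoop G A B (1 - p) d K x0 u0 (fun _ => 1 - p) k).x j
        - (closedLoop G A B (1 - p) d K x0 u0 (fun _ => 1 - p) k).x i) atTop (𝓝 0) := by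
  obtain ⟨K, hK⟩ := hcons x0 u0
  refine ⟨K, fun i j => tendsto_pi_nhds.2 fun a => ?_⟩
  have hm := fun k => (hasPathMean_closedLoop hγ hp0 hp1 G A B (1 - p) d K x0 u0 k).1
  have hsub := fun k => (hm k j a).sub hγ (hm k i a)
  have := tendsto_integral_coord a (fun k => (hsub k).integrable hγ) (hK i j)
  exact this.congr fun k => (hsub k).integral_eq

/-! ### The averaged loop, seen through its predictor -/

section AveragedLoop

variable {N n m : ℕ}

/-- The state of agent `i` after `l ≤ d` further steps, when packets are replaced by their
mean `μ`; it only involves inputs already sent. For `l = d` it is the predictor. -/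
noncomputable def partialPredictor (A : Matrix (Fin n) (Fin n) ℝ) (B : Matrix (Fin n) (Fin m) ℝ)
    (μ : ℝ) (d l : ℕ) (s : LoopState N n m) (i : Fin N) : Fin n → ℝ :=
  (A ^ l).mulVec (s.x i)
    + μ • ∑ j ∈ Finset.range l, (A ^ j * B).mulVec (s.past (j + (d - l)) i)

variable (G : CommGraph N) (A : Matrix (Fin n) (Fin n) ℝ) (B : Matrix (Fin n) (Fin m) ℝ) (μ : ℝ)
  (d : ℕ) (K : Matrix (Fin m) (Fin n) ℝ)

theorem predictor_eq_partialPredictor (s : LoopState N n m) (i : Fin N) :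
    predictor A B μ d s i = partialPredictor A B μ d d s i := by
  rw [predictor, partialPredictor, ← Finset.Ico_add_one_right_eq_Icc,
    Finset.sum_Ico_eq_sum_range]
  simp

theorem partialPredictor_loopStep {l : ℕ} (hl : l < d) (s : LoopState N n m) (i : Fin N) :
    partialPredictor A B μ d l (loopStep G A B μ d K μ s) i
      = partialPredictor A B μ d (l + 1) s i := by
  obtain ⟨e, rfl⟩ : ∃ e, d = l + 1 + e := ⟨d - (l + 1), by omega⟩
  have h1 : l + 1 + e - l = e + 1 := by omega
  have h2 : l + 1 + e - (l + 1) = e := by omega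
  have h3 : l + 1 + e = (l + e) + 1 := by omega
  simp only [partialPredictor, loopStep, h1, h2]
  rw [Finset.sum_range_succ, Matrix.mulVec_add, Matrix.mulVec_mulVec, ← pow_succ,
    Matrix.mulVec_smul, Matrix.mulVec_mulVec, smul_add]
  simp only [h3, ← add_assoc, extendInputs]
  abel

theorem predictor_loopStep (s : LoopState N n m) (i : Fin N) :
    predictor A B μ d (loopStep G A B μ d K μ s) i
      = A.mulVec (predictor A B μ d s i) + μ • B.mulVec (protocolInput G A B μ d K s i) := by
  have key : ∀ f : ℕ → Fin m → ℝ,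
      (A ^ d * B).mulVec (f d) + ∑ j ∈ Finset.range d, (A ^ j * B).mulVec (f j)
        = A.mulVec (∑ j ∈ Finset.range d, (A ^ j * B).mulVec (f (j + 1))) + B.mulVec (f 0) := by
    intro f
    rw [add_comm, ← Finset.sum_range_succ (fun j => (A ^ j * B).mulVec (f j)),
      Finset.sum_range_succ', Matrix.mulVec_sum]
    simp only [Matrix.mulVec_mulVec, ← Matrix.mul_assoc, ← pow_succ', pow_zero, Matrix.one_mul]
  rw [predictor_eq_partialPredictor, predictor_eq_partialPredictor]
  have := key fun j => extendInputs (protocolInput G A B μ d K s) s.past j i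
  simp only [extendInputs] at this
  simp only [partialPredictor, loopStep, Nat.sub_self, add_zero]
  rw [Matrix.mulVec_add, Matrix.mulVec_smul, Matrix.mulVec_mulVec, Matrix.mulVec_mulVec,
    Matrix.mulVec_add, Matrix.mulVec_smul, Matrix.mulVec_mulVec, ← pow_succ, ← pow_succ',
    add_assoc, add_assoc, ← smul_add, ← smul_add]
  simp only [extendInputs] at this ⊢
  rw [this]

variable (x0 : Fin N → Fin n → ℝ) (u0 : Fin d → Fin N → Fin m → ℝ)

theorem closedLoop_x_add_eq_predictor (k : ℕ) (i : Fin N) :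
    (closedLoop G A B μ d K x0 u0 (fun _ => μ) (k + d)).x i
      = predictor A B μ d (closedLoop G A B μ d K x0 u0 (fun _ => μ) k) i := by
  have key : ∀ l ≤ d, partialPredictor A B μ d (d - l)
      (closedLoop G A B μ d K x0 u0 (fun _ => μ) (k + l)) i
        = partialPredictor A B μ d d (closedLoop G A B μ d K x0 u0 (fun _ => μ) k) i := by
    intro l
    induction l with
    | zero => simp
    | succ l ih =>
      intro hl
      rw [← ih (by omega), ← add_assoc]
      have h : d - l = (d - (l + 1)) + 1 := by omega
      rw [h]
      exact partialPredictor_loopStep G A B μ d K (by omega) _ i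
  rw [predictor_eq_partialPredictor, ← key d le_rfl]
  simp [partialPredictor]

theorem laplacian_mulVec_apply (v : Fin N → ℝ) (i : Fin N) :
    G.laplacian.mulVec v i = ∑ j, G.weight i j * (v i - v j) := by
  rw [CommGraph.laplacian, Matrix.sub_mulVec, Pi.sub_apply, Matrix.mulVec_diagonal]
  simp [mul_sub, Finset.sum_mul, Matrix.mulVec, dotProduct]

/-- A Laplacian eigenvector with nonzero eigenvalue is orthogonal to the constant vectors. -/
theorem sum_eq_zero_of_laplacian_mulVec {v : Fin N → ℝ} {c : ℝ} (hc : c ≠ 0)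
    (hv : G.laplacian.mulVec v = c • v) : ∑ i, v i = 0 := by
  have h : ∑ i, ∑ j, G.weight i j * (v i - v j) = c * ∑ i, v i := by
    simp_rw [← laplacian_mulVec_apply, hv, Finset.mul_sum, Pi.smul_apply, smul_eq_mul]
  have h' : ∑ i, ∑ j, G.weight i j * (v i - v j) = -∑ i, ∑ j, G.weight i j * (v i - v j) := by
    conv_lhs => rw [Finset.sum_comm]
    simp_rw [← Finset.sum_neg_distrib]
    refine Finset.sum_congr rfl fun i _ => Finset.sum_congr rfl fun j _ => ?_
    rw [G.symm.apply i j]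
    ring
  have h0 : c * ∑ i, v i = 0 := by linarith
  exact (mul_eq_zero.1 h0).resolve_left hc

theorem sum_smul_weight_sub {v : Fin N → ℝ} {c : ℝ} (hv : G.laplacian.mulVec v = c • v)
    (z : Fin N → Fin n → ℝ) :
    ∑ i, v i • ∑ j, G.weight i j • (z j - z i) = -(c • ∑ i, v i • z i) := by
  have h : ∀ i, c * v i = ∑ j, G.weight i j * (v i - v j) := fun i => by
    rw [← laplacian_mulVec_apply, hv]; rfl
  have h2 : c • ∑ i, v i • z i = ∑ i, ∑ j, (G.weight i j * (v i - v j)) • z i := by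
    simp_rw [Finset.smul_sum, smul_smul, h, Finset.sum_smul]
  rw [h2]
  simp_rw [Finset.smul_sum, smul_sub, mul_sub, sub_smul, Finset.sum_sub_distrib, smul_smul]
  rw [neg_sub]
  congr 1
  · rw [Finset.sum_comm]
    refine Finset.sum_congr rfl fun i _ => Finset.sum_congr rfl fun j _ => ?_
    rw [G.symm.apply i j, mul_comm]
  · refine Finset.sum_congr rfl fun i _ => Finset.sum_congr rfl fun j _ => ?_
    rw [mul_comm]

/-- Along a Laplacian eigenvector the averaged predictors decouple: they follow the powers of
`A - c μ B K`, where `c` is the eigenvalue. -/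
theorem sum_smul_predictor {v : Fin N → ℝ} {c : ℝ} (hv : G.laplacian.mulVec v = c • v) (k : ℕ) :
    ∑ i, v i • predictor A B μ d (closedLoop G A B μ d K x0 u0 (fun _ => μ) k) i
      = ((A - (c * μ) • (B * K)) ^ k).mulVec
        (∑ i, v i • predictor A B μ d (closedLoop G A B μ d K x0 u0 (fun _ => μ) 0) i) := by
  induction k with
  | zero => simp
  | succ k ih =>
    rw [pow_succ', ← Matrix.mulVec_mulVec, ← ih]
    set s := closedLoop G A B μ d K x0 u0 (fun _ => μ) k
    have hs : closedLoop G A B μ d K x0 u0 (fun _ => μ) (k + 1) = loopStep G A B μ d K μ s := rfl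
    have h1 : ∑ i, v i • protocolInput G A B μ d K s i
        = -(c • K.mulVec (∑ i, v i • predictor A B μ d s i)) := by
      rw [← Matrix.mulVec_smul, ← Matrix.mulVec_neg, ← sum_smul_weight_sub G hv,
        Matrix.mulVec_sum]
      simp only [protocolInput, Matrix.mulVec_smul]
    rw [hs]
    simp only [predictor_loopStep, smul_add, Finset.sum_add_distrib]
    simp_rw [smul_comm _ μ, ← Finset.smul_sum, ← Matrix.mulVec_smul, ← Matrix.mulVec_sum, h1]
    rw [Matrix.sub_mulVec, Matrix.smul_mulVec, ← Matrix.mulVec_mulVec]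
    simp only [Matrix.mulVec_smul, Matrix.mulVec_neg, smul_neg, smul_smul]
    rw [mul_comm μ c, sub_eq_add_neg]

end AveragedLoop

/-- Consensus of the averaged loop, read off along the Laplacian eigenvectors. Here `u0 = 0`, so
that the initial predictors are `A ^ d x0`. -/
theorem MeanSquareConsensusable.tendsto_modes {Ω : Type*} [MeasurableSpace Ω] {P : Measure Ω}
    [IsProbabilityMeasure P] {N n m d : ℕ} {p : ℝ} (hp0 : 0 < p) (hp1 : p < 1) {γ : ℕ → Ω → ℝ}
    (hγ : IsPacketProcess P γ p) {G : CommGraph N} {A : Matrix (Fin n) (Fin n) ℝ}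
    {B : Matrix (Fin n) (Fin m) ℝ} (hcons : MeanSquareConsensusable P γ p d G A B)
    (x0 : Fin N → Fin n → ℝ) :
    ∃ K : Matrix (Fin m) (Fin n) ℝ, ∀ (v : Fin N → ℝ) (c : ℝ), c ≠ 0 →
      G.laplacian.mulVec v = c • v →
      Tendsto (fun k => ((A - (c * (1 - p)) • (B * K)) ^ k).mulVec
        ((A ^ d).mulVec (∑ i, v i • x0 i))) atTop (𝓝 0) := by
  obtain ⟨K, hK⟩ := hcons.averaged hp0 hp1 hγ x0 0
  refine ⟨K, fun v c hc hv => ?_⟩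
  have hsum := sum_eq_zero_of_laplacian_mulVec G hc hv
  rcases N with _ | N
  · simp
  have h0 : (A ^ d).mulVec (∑ i, v i • x0 i) = ∑ i, v i • predictor A B (1 - p) d
      (closedLoop G A B (1 - p) d K x0 0 (fun _ => 1 - p) 0) i := by
    have hpast : ∀ j i, (closedLoop G A B (1 - p) d K x0 0 (fun _ => 1 - p) 0).past j i = 0 := by
      intro j i
      simp only [closedLoop]
      split_ifs <;> rfl
    simp only [predictor, hpast, Matrix.mulVec_zero, Finset.sum_const_zero, smul_zero, add_zero,
      Matrix.mulVec_sum, Matrix.mulVec_smul]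
    rfl
  rw [h0]
  simp_rw [← sum_smul_predictor G A B (1 - p) d K x0 0 hv, ← closedLoop_x_add_eq_predictor]
  -- the weights `v i` sum to zero, so that only differences to the state of agent `0` matter
  have h1 : ∀ z : Fin (N + 1) → Fin n → ℝ, ∑ i, v i • z i = ∑ i, v i • (z i - z 0) := by
    intro z
    simp [smul_sub, ← Finset.sum_smul, hsum]
  refine Tendsto.congr (fun k => (h1 _).symm) ?_
  have h2 := tendsto_finsetSum (Finset.univ : Finset (Fin (N + 1))) fun i _ =>
    (((hK 0 i).comp (tendsto_add_atTop_nat d)).const_smul (v i))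
  simpa [Function.comp_def] using h2

/-! ### Single-input stabilization -/

section LinearAlgebra

variable {n m : ℕ}

theorem prod_norm_complexEigenvalues (A : Matrix (Fin n) (Fin n) ℝ) :
    ((complexEigenvalues A).map fun z => ‖z‖).prod = |A.det| := by
  have h := Matrix.det_eq_prod_roots_charpoly (A.map (algebraMap ℝ ℂ))
  have h2 : (A.map (algebraMap ℝ ℂ)).det = ((A.det : ℝ) : ℂ) :=
    ((algebraMap ℝ ℂ).map_det A).symm
  have h3 := Multiset.prod_hom (complexEigenvalues A) (normHom : ℂ →*₀ ℝ)
  change _ = ‖(complexEigenvalues A).prod‖ at h3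
  rw [complexEigenvalues, ← h, h2, Complex.norm_real, Real.norm_eq_abs] at h3
  exact h3

theorem det_ne_zero_of_complexEigenvalues {A : Matrix (Fin n) (Fin n) ℝ}
    (hA : ∀ z ∈ complexEigenvalues A, 1 ≤ ‖z‖) : A.det ≠ 0 := by
  rw [← abs_ne_zero, ← prod_norm_complexEigenvalues]
  refine Multiset.prod_ne_zero fun h => ?_
  obtain ⟨z, hz, h0⟩ := Multiset.mem_map.1 h
  have := hA z hz
  linarith

/-- If every initial state can be steered to zero by some static gain and no eigenvalue of `A` is
inside the unit disc, then `(A, B)` is controllable: a complex covector annihilating all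
`A ^ j B` would otherwise generate a left eigenvector `y` of `A` with `y B = 0`, and no feedback
acts on `y x`. -/
theorem controllable_of_steerable {A : Matrix (Fin n) (Fin n) ℝ} {B : Matrix (Fin n) (Fin m) ℝ}
    (hA : ∀ z ∈ complexEigenvalues A, 1 ≤ ‖z‖)
    (h : ∀ ζ : Fin n → ℝ, ∃ K : Matrix (Fin m) (Fin n) ℝ,
      Tendsto (fun k => ((A - B * K) ^ k).mulVec ζ) atTop (𝓝 0))
    (y : Fin n → ℝ) (hy : ∀ j : ℕ, Matrix.vecMul y (A ^ j * B) = 0) : y = 0 := by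
  classical
  set φ := algebraMap ℝ ℂ
  set T : (Fin n → ℂ) →ₗ[ℂ] (Fin n → ℂ) := Matrix.vecMulLinear (A.map φ) with hT
  let D : Submodule ℂ (Fin n → ℂ) :=
    ⨅ j : ℕ, LinearMap.ker (Matrix.vecMulLinear ((A ^ j * B).map φ))
  have hD : ∀ w, w ∈ D ↔ ∀ j : ℕ, Matrix.vecMul w ((A ^ j * B).map φ) = 0 := by
    intro w
    simp [D, Submodule.mem_iInf]
  have hTD : ∀ w ∈ D, T w ∈ D := by
    intro w hw
    rw [hD] at hw ⊢
    intro j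
    have := hw (j + 1)
    rw [pow_succ', Matrix.mul_assoc, Matrix.map_mul, ← Matrix.vecMul_vecMul] at this
    exact this
  by_contra hy0
  have hyD : (fun i => φ (y i)) ∈ D := by
    rw [hD]
    intro j
    have := congrArg (fun u : Fin m → ℝ => φ ∘ u) (hy j)
    ext i
    have h1 := congrFun this i
    simp only [Function.comp, RingHom.map_vecMul] at h1
    simpa [Function.comp_def] using h1
  have hnt : Nontrivial D := by
    refine ⟨⟨⟨_, hyD⟩, 0, fun h0 => hy0 ?_⟩⟩
    have h1 := congrArg Subtype.val h0
    ext i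
    have h2 := congrFun h1 i
    simpa [φ] using h2
  obtain ⟨z, hz⟩ := Module.End.exists_eigenvalue (T.restrict hTD)
  obtain ⟨⟨w, hwD⟩, hw⟩ := hz.exists_hasEigenvector
  have hw0 : w ≠ 0 := fun h0 => hw.2 (by ext1; exact h0)
  have hwz : Matrix.vecMul w (A.map φ) = z • w := by
    have := congrArg Subtype.val hw.apply_eq_smul
    exact this
  have hzmem : z ∈ complexEigenvalues A := by
    have h1 : (A.map φ).charpoly.IsRoot z := by
      rw [← Matrix.charpoly_transpose, ← Matrix.mem_spectrum_iff_isRoot_charpoly,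
        ← Matrix.spectrum_toLin', ← Module.End.hasEigenvalue_iff_mem_spectrum]
      refine Module.End.hasEigenvalue_of_hasEigenvector (x := w) ⟨?_, hw0⟩
      rw [Module.End.mem_eigenspace_iff, Matrix.toLin'_apply, Matrix.mulVec_transpose, hwz]
    exact (Polynomial.mem_roots (Matrix.charpoly_monic _).ne_zero).2 h1
  have hwB : Matrix.vecMul w (B.map φ) = 0 := by simpa using (hD w).1 hwD 0
  obtain ⟨i, hi⟩ := Function.ne_iff.1 hw0
  obtain ⟨K, hK⟩ := h (Pi.single i 1)
  -- the feedback is invisible to `w`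
  have hstep : Matrix.vecMul w ((A - B * K).map φ) = z • w := by
    rw [Matrix.map_sub _ (map_sub φ), Matrix.map_mul, Matrix.vecMul_sub, ← Matrix.vecMul_vecMul,
      hwB, Matrix.zero_vecMul, sub_zero, hwz]
  have hpow : ∀ k : ℕ, Matrix.vecMul w (((A - B * K) ^ k).map φ) = z ^ k • w := by
    intro k
    induction k with
    | zero => simp
    | succ k ih =>
      rw [pow_succ, Matrix.map_mul, ← Matrix.vecMul_vecMul, ih, Matrix.smul_vecMul, hstep,
        smul_smul, pow_succ]
  have hval : ∀ k : ℕ, ∑ a, w a * φ (((A - B * K) ^ k).mulVec (Pi.single i 1) a)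
      = z ^ k * w i := by
    intro k
    have := congrFun (hpow k) i
    simpa [Matrix.vecMul, dotProduct] using this
  have hlim : Tendsto (fun k : ℕ => z ^ k * w i) atTop (𝓝 0) := by
    have h1 : Continuous fun u : Fin n → ℝ => ∑ a, w a * φ (u a) := by
      have : Continuous φ := Complex.continuous_ofReal
      fun_prop
    have h2 := (h1.tendsto 0).comp hK
    simp only [Function.comp_def, hval] at h2
    simpa using h2
  have hnorm := hlim.norm
  rw [norm_zero] at hnorm
  have hge : ‖w i‖ ≤ 0 := by
    refine ge_of_tendsto' hnorm fun k => ?_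
    rw [norm_mul, norm_pow]
    exact le_mul_of_one_le_left (norm_nonneg _) (one_le_pow₀ (hA z hzmem))
  exact hi (norm_le_zero_iff.1 hge)

/-- For a controllable single-input pair it is enough that the closed loop contracts the input
vector: the states it contracts form an `A`-invariant subspace. -/
theorem abs_det_lt_one_of_tendsto [NeZero n] {A : Matrix (Fin n) (Fin n) ℝ}
    {B : Matrix (Fin n) (Fin 1) ℝ}
    (hctrl : ∀ y : Fin n → ℝ, (∀ j : ℕ, Matrix.vecMul y (A ^ j * B) = 0) → y = 0)
    (K : Matrix (Fin 1) (Fin n) ℝ)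
    (h : Tendsto (fun k => ((A - B * K) ^ k).mulVec (B.mulVec 1)) atTop (𝓝 0)) :
    |(A - B * K).det| < 1 := by
  set M := A - B * K with hM
  let S : Submodule ℝ (Fin n → ℝ) :=
    { carrier := {v | Tendsto (fun k => (M ^ k).mulVec v) atTop (𝓝 0)}
      add_mem' := fun {v w} hv hw => by
        simpa [Matrix.mulVec_add] using Tendsto.add hv hw
      zero_mem' := by simp
      smul_mem' := fun c v hv => by
        simpa [Matrix.mulVec_smul] using Tendsto.const_smul hv c }
  have hB : ∀ u : Fin 1 → ℝ, B.mulVec u ∈ S := by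
    intro u
    have hu : u = u 0 • (1 : Fin 1 → ℝ) := by
      ext i
      simp [Subsingleton.elim i 0]
    rw [hu, Matrix.mulVec_smul]
    exact S.smul_mem _ h
  have hSM : ∀ v ∈ S, M.mulVec v ∈ S := by
    intro v hv
    have h1 : Tendsto (fun k => (M ^ (k + 1)).mulVec v) atTop (𝓝 0) :=
      (tendsto_add_atTop_iff_nat 1).2 hv
    simp only [pow_succ, ← Matrix.mulVec_mulVec] at h1
    exact h1
  have hSA : ∀ v ∈ S, A.mulVec v ∈ S := by
    intro v hv
    have h1 : A.mulVec v = M.mulVec v + B.mulVec (K.mulVec v) := by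
      rw [hM, Matrix.sub_mulVec, Matrix.mulVec_mulVec, sub_add_cancel]
    rw [h1]
    exact S.add_mem (hSM v hv) (hB _)
  have hAB : ∀ (j : ℕ) (u : Fin 1 → ℝ), (A ^ j * B).mulVec u ∈ S := by
    intro j u
    induction j with
    | zero => simpa using hB u
    | succ j ih =>
      rw [pow_succ', Matrix.mul_assoc, ← Matrix.mulVec_mulVec]
      exact hSA _ ih
  have hS : S = ⊤ := by
    by_contra hne
    obtain ⟨f, hf0, hf⟩ := Submodule.exists_le_ker_of_lt_top S (lt_top_iff_ne_top.2 hne)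
    have hfy : ∀ v, f v = dotProduct (fun i => f (Pi.single i 1)) v := by
      intro v
      conv_lhs => rw [pi_eq_sum_univ' v]
      simp [dotProduct, map_sum, mul_comm, Pi.single]
    have hy := hctrl (fun i => f (Pi.single i 1)) fun j => by
      ext a
      have h1 := hf (hAB j (Pi.single a 1))
      rw [LinearMap.mem_ker, hfy, Matrix.dotProduct_mulVec] at h1
      simpa using h1
    refine hf0 (LinearMap.ext fun v => ?_)
    rw [hfy, hy]
    simp
  have hMk : Tendsto (fun k => M ^ k) atTop (𝓝 0) := by
    refine tendsto_pi_nhds.2 fun i => tendsto_pi_nhds.2 fun j => ?_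
    have h1 : Pi.single j 1 ∈ S := hS ▸ Submodule.mem_top
    have h2 := tendsto_pi_nhds.1 (show Tendsto (fun k => (M ^ k).mulVec (Pi.single j 1))
      atTop (𝓝 0) from h1) i
    simpa using h2
  have hdet : Tendsto (fun k => M.det ^ k) atTop (𝓝 0) := by
    have hc : Continuous fun X : Matrix (Fin n) (Fin n) ℝ => X.det := continuous_id.matrix_det
    have h2 := (hc.tendsto 0).comp hMk
    rw [Matrix.det_zero] at h2
    simpa [Function.comp_def, Matrix.det_pow] using h2
  exact tendsto_pow_atTop_nhds_zero_iff.1 hdet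

/-- A rank-one perturbation changes the determinant affinely in its size. -/
theorem exists_det_sub_smul_eq {A : Matrix (Fin n) (Fin n) ℝ} (hA : A.det ≠ 0)
    (B : Matrix (Fin n) (Fin 1) ℝ) (K : Matrix (Fin 1) (Fin n) ℝ) :
    ∃ q : ℝ, ∀ c : ℝ, (A - c • (B * K)).det = A.det - c * q := by
  refine ⟨A.det * (K * (A⁻¹ * B)) 0 0, fun c => ?_⟩
  have hu : IsUnit A.det := isUnit_iff_ne_zero.2 hA
  have h1 : A - c • (B * K) = A * (1 - (A⁻¹ * B) * (c • K)) := by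
    rw [Matrix.mul_sub, Matrix.mul_one, Matrix.mul_assoc, Matrix.mul_smul, Matrix.mul_smul,
      Matrix.mul_smul, Matrix.mul_nonsing_inv_cancel_left _ _ hu]
  rw [h1, Matrix.det_mul, Matrix.det_one_sub_mul_comm, Matrix.det_fin_one]
  simp [Matrix.smul_mul]
  ring

/-- Extrapolation to `0` of an affine function that is smaller than `1` in modulus at `a` and
`b`. -/
theorem abs_lt_of_affine {D q a b : ℝ} (ha : 0 < a) (hab : a < b) (h1 : |D - a * q| < 1)
    (h2 : |D - b * q| < 1) : |D| < (1 + a / b) / (1 - a / b) := by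
  have hb : 0 < b := ha.trans hab
  have h3 : (1 + a / b) / (1 - a / b) = (b + a) / (b - a) := by
    have : b - a ≠ 0 := (sub_pos.2 hab).ne'
    field_simp
  rw [h3, lt_div_iff₀ (sub_pos.2 hab), ← abs_of_pos (sub_pos.2 hab), ← abs_mul]
  rw [abs_lt] at h1 h2 ⊢
  constructor <;> nlinarith

end LinearAlgebra

/-! ### The Laplacian spectrum -/

namespace CommGraph

variable {N : ℕ} (G : CommGraph N)

/-- An orthonormal basis of eigenvectors of the Laplacian, sorted as `CommGraph.eig`. -/
noncomputable def eigVec (i : Fin N) : Fin N → ℝ :=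
  G.laplacian_isHermitian.eigenvectorBasis (Tuple.sort G.laplacian_isHermitian.eigenvalues i)

theorem laplacian_mulVec_eigVec (i : Fin N) :
    G.laplacian.mulVec (G.eigVec i) = G.eig i • G.eigVec i :=
  G.laplacian_isHermitian.mulVec_eigenvectorBasis _

theorem eigVec_dotProduct (i j : Fin N) :
    ∑ l, G.eigVec i l * G.eigVec j l = if i = j then 1 else 0 := by
  have h := orthonormal_iff_ite.1 G.laplacian_isHermitian.eigenvectorBasis.orthonormal
    (Tuple.sort G.laplacian_isHermitian.eigenvalues j)
    (Tuple.sort G.laplacian_isHermitian.eigenvalues i)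
  simp only [PiLp.inner_apply, RCLike.inner_apply, conj_trivial,
    (Equiv.injective _).eq_iff] at h
  simpa [eigVec, eq_comm] using h

/-- The Laplacian quadratic form is the weighted sum of squared differences. -/
theorem two_mul_dotProduct_laplacian (v : Fin N → ℝ) :
    2 * dotProduct v (G.laplacian.mulVec v) = ∑ i, ∑ j, G.weight i j * (v i - v j) ^ 2 := by
  simp only [dotProduct, laplacian_mulVec_apply, Finset.mul_sum]
  have h : ∑ i, ∑ j, v i * (G.weight i j * (v i - v j))
      = ∑ i, ∑ j, v j * (G.weight i j * (v j - v i)) := by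
    rw [Finset.sum_comm]
    refine Finset.sum_congr rfl fun i _ => Finset.sum_congr rfl fun j _ => ?_
    rw [G.symm.apply i j]
  have h2 : ∑ i, ∑ j, 2 * (v i * (G.weight i j * (v i - v j)))
      = ∑ i, ∑ j, v i * (G.weight i j * (v i - v j))
        + ∑ i, ∑ j, v j * (G.weight i j * (v j - v i)) := by
    rw [← h]
    simp_rw [two_mul, Finset.sum_add_distrib]
  rw [h2, ← Finset.sum_add_distrib]
  refine Finset.sum_congr rfl fun i _ => ?_
  rw [← Finset.sum_add_distrib]
  refine Finset.sum_congr rfl fun j _ => ?_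
  ring

theorem eig_nonneg (i : Fin N) : 0 ≤ G.eig i := by
  have h := G.two_mul_dotProduct_laplacian (G.eigVec i)
  rw [laplacian_mulVec_eigVec, dotProduct_smul] at h
  have h1 : dotProduct (G.eigVec i) (G.eigVec i) = 1 := by
    simpa [dotProduct] using G.eigVec_dotProduct i i
  rw [h1, smul_eq_mul, mul_one] at h
  have h2 : 0 ≤ ∑ a, ∑ b, G.weight a b * (G.eigVec i a - G.eigVec i b) ^ 2 :=
    Finset.sum_nonneg fun a _ => Finset.sum_nonneg fun b _ =>
      mul_nonneg (G.nonneg a b) (sq_nonneg _)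
  linarith

theorem eq_of_laplacian_mulVec_eq_zero (hG : G.toSimpleGraph.Connected) {v : Fin N → ℝ}
    (hv : G.laplacian.mulVec v = 0) (i j : Fin N) : v i = v j := by
  have h := G.two_mul_dotProduct_laplacian v
  rw [hv, dotProduct_zero, mul_zero] at h
  have h0 : ∀ a b, G.weight a b * (v a - v b) ^ 2 = 0 := by
    intro a b
    have hnn : ∀ a b, 0 ≤ G.weight a b * (v a - v b) ^ 2 := fun a b =>
      mul_nonneg (G.nonneg a b) (sq_nonneg _)
    have h1 := (Finset.sum_eq_zero_iff_of_nonneg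
      fun a _ => Finset.sum_nonneg fun b _ => hnn a b).1 h.symm a (Finset.mem_univ a)
    exact (Finset.sum_eq_zero_iff_of_nonneg fun b _ => hnn a b).1 h1 b (Finset.mem_univ b)
  have hadj : ∀ a b, G.toSimpleGraph.Adj a b → v a = v b := by
    intro a b hab
    rw [toSimpleGraph, SimpleGraph.fromRel_adj] at hab
    rcases hab.2 with hw | hw
    · exact sub_eq_zero.1 (pow_eq_zero_iff two_ne_zero |>.1
        ((mul_eq_zero.1 (h0 a b)).resolve_left hw.ne'))
    · exact (sub_eq_zero.1 (pow_eq_zero_iff two_ne_zero |>.1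
        ((mul_eq_zero.1 (h0 b a)).resolve_left hw.ne'))).symm
  obtain ⟨w⟩ := hG.preconnected i j
  induction w with
  | nil => rfl
  | cons hab _ ih => exact (hadj _ _ hab).trans ih

/-- The algebraic connectivity of a connected graph is positive. -/
theorem eig_one_pos (hN : 2 ≤ N) (hG : G.toSimpleGraph.Connected) :
    0 < G.eig ⟨1, by omega⟩ := by
  refine lt_of_le_of_ne (G.eig_nonneg _) fun h => ?_
  have h0 : G.eig ⟨0, by omega⟩ = 0 :=
    le_antisymm (h ▸ G.eig_monotone (by simp)) (G.eig_nonneg _)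
  -- two orthonormal vectors cannot both be constant
  have hc : ∀ i, G.eig i = 0 → ∃ c : ℝ, ∀ a, G.eigVec i a = c := fun i hi =>
    ⟨G.eigVec i ⟨0, by omega⟩, fun a => G.eq_of_laplacian_mulVec_eq_zero hG
      (by rw [laplacian_mulVec_eigVec, hi, zero_smul]) a _⟩
  obtain ⟨c, hc'⟩ := hc _ h0
  obtain ⟨e, he⟩ := hc _ h.symm
  have h1 := G.eigVec_dotProduct ⟨0, by omega⟩ ⟨0, by omega⟩
  have h2 := G.eigVec_dotProduct ⟨1, by omega⟩ ⟨1, by omega⟩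
  have h3 := G.eigVec_dotProduct ⟨0, by omega⟩ ⟨1, by omega⟩
  simp only [hc', he] at h1 h2 h3
  simp at h1 h2 h3
  rcases h3 with h3 | h3 | h3
  · omega
  · simp [h3] at h1
  · simp [h3] at h2

end CommGraph

/-! ### The consensusability bound -/

/-- The initial values can be chosen so that the modes of two distinct Laplacian eigenvectors both
start at a prescribed `ζ`; one gain then steers both to zero. -/
theorem MeanSquareConsensusable.exists_gain {Ω : Type*} [MeasurableSpace Ω] {P : Measure Ω}
    [IsProbabilityMeasure P] {N n m d : ℕ} {p : ℝ} (hp0 : 0 < p) (hp1 : p < 1) {γ : ℕ → Ω → ℝ}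
    (hγ : IsPacketProcess P γ p) {G : CommGraph N} {A : Matrix (Fin n) (Fin n) ℝ}
    {B : Matrix (Fin n) (Fin m) ℝ} (hcons : MeanSquareConsensusable P γ p d G A B)
    (hA : A.det ≠ 0) {r s : Fin N} (hrs : r ≠ s) (hr : G.eig r ≠ 0) (hs : G.eig s ≠ 0)
    (ζ : Fin n → ℝ) :
    ∃ K : Matrix (Fin m) (Fin n) ℝ,
      Tendsto (fun k => ((A - (G.eig r * (1 - p)) • (B * K)) ^ k).mulVec ζ) atTop (𝓝 0) ∧
      Tendsto (fun k => ((A - (G.eig s * (1 - p)) • (B * K)) ^ k).mulVec ζ) atTop (𝓝 0) := by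
  set ξ := ((A ^ d)⁻¹).mulVec ζ with hξ
  have hAξ : (A ^ d).mulVec ξ = ζ := by
    rw [hξ, Matrix.mulVec_mulVec, Matrix.mul_nonsing_inv, Matrix.one_mulVec]
    rw [Matrix.det_pow]
    exact isUnit_iff_ne_zero.2 (pow_ne_zero _ hA)
  obtain ⟨K, hK⟩ := hcons.tendsto_modes hp0 hp1 hγ fun i => (G.eigVec r i + G.eigVec s i) • ξ
  have hsum : ∀ t, ∑ i, G.eigVec t i • (G.eigVec r i + G.eigVec s i) • ξ
      = ((if t = r then 1 else 0) + if t = s then 1 else 0 : ℝ) • ξ := by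
    intro t
    rw [← G.eigVec_dotProduct t r, ← G.eigVec_dotProduct t s, ← Finset.sum_add_distrib,
      Finset.sum_smul]
    simp only [smul_smul, mul_add]
  refine ⟨K, ?_, ?_⟩
  · simpa [hsum, hrs, hAξ] using hK _ _ hr (G.laplacian_mulVec_eigVec r)
  · simpa [hsum, hrs.symm, hAξ] using hK _ _ hs (G.laplacian_mulVec_eigVec s)

theorem theorem4 {Ω : Type*} [MeasurableSpace Ω] (P : Measure Ω) [IsProbabilityMeasure P]
    (N n m d : ℕ) (hN : 2 ≤ N)
    (p : ℝ) (hp0 : 0 < p) (hp1 : p < 1)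
    (γ : ℕ → Ω → ℝ) (hγ : IsPacketProcess P γ p)
    (G : CommGraph N) (hG : G.toSimpleGraph.Connected)
    (A : Matrix (Fin n) (Fin n) ℝ) (B : Matrix (Fin n) (Fin m) ℝ)
    (hA : ∀ z ∈ complexEigenvalues A, 1 ≤ ‖z‖)
    (hBfull : B.rank = m) (hB : B.rank = 1)
    (hcons : MeanSquareConsensusable P γ p d G A B)
    (lam2 lamN : ℝ) (hlam2 : lam2 = G.eig ⟨1, by omega⟩)
    (hlamN : lamN = G.eig ⟨N - 1, by omega⟩)
    (hne : lam2 ≠ lamN) :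
    ((unstableEigenvalues A).map fun z => ‖z‖ ^ 2).prod
      < ((1 + lam2 / lamN) / (1 - lam2 / lamN)) ^ 2 := by
  obtain rfl : m = 1 := hBfull.symm.trans hB
  have : NeZero n := ⟨fun hn => by
    have := B.rank_le_height
    omega⟩
  have h2 : 0 < lam2 := hlam2 ▸ G.eig_one_pos hN hG
  have h2N : lam2 < lamN := by
    refine lt_of_le_of_ne ?_ hne
    rw [hlam2, hlamN]
    exact G.eig_monotone (Fin.mk_le_mk.2 (by omega))
  have hdet := det_ne_zero_of_complexEigenvalues hA
  have hidx : (⟨1, by omega⟩ : Fin N) ≠ ⟨N - 1, by omega⟩ := fun h => hne (by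
    rw [hlam2, hlamN, h])
  have hgain := hcons.exists_gain hp0 hp1 hγ hdet hidx (by rw [← hlam2]; exact h2.ne')
    (by rw [← hlamN]; exact (h2.trans h2N).ne')
  rw [← hlam2, ← hlamN] at hgain
  simp_rw [← Matrix.mul_smul] at hgain
  have hctrl := controllable_of_steerable (B := B) hA fun ζ => by
    obtain ⟨K, hK, -⟩ := hgain ζ
    exact ⟨_, hK⟩
  -- `B.mulVec 1` is the single column of `B`
  obtain ⟨K, hK2, hKN⟩ := hgain (B.mulVec 1)
  have hd2 := abs_det_lt_one_of_tendsto hctrl _ hK2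
  have hdN := abs_det_lt_one_of_tendsto hctrl _ hKN
  obtain ⟨q, hq⟩ := exists_det_sub_smul_eq hdet B K
  rw [Matrix.mul_smul, hq, mul_assoc] at hd2 hdN
  have hlt := abs_lt_of_affine h2 h2N hd2 hdN
  have hun : unstableEigenvalues A = complexEigenvalues A := Multiset.filter_eq_self.2 hA
  rw [hun, Multiset.prod_map_pow, prod_norm_complexEigenvalues]
  exact pow_lt_pow_left₀ hlt (abs_nonneg _) two_ne_zero
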